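/- Assume the continuum hypothesis, $\aleph_1 = 2^{\aleph_0}$. Let $\omega^* = \beta\omega \setminus \omega$ be the Stone–Čech remainder of the countable discrete space $\omega$, and let $x \in \omega^*$. A finite compactification of $\omega^* \setminus \{x\}$ is a compact Hausdorff space $Z$ together with a homeomorphism of $\omega^* \setminus \{x\}$ onto a dense subspace of $Z$ whose complement in $Z$ (the remainder) is finite. Then every finite compactification $Z$ of $\omega^* \setminus \{x\}$ is homeomorphic to $\omega^*$. Moreover, at most one point of the remainder is not a $P$-point of $Z$, where a point $p$ of $Z$ is a $P$-point if every countable intersection of neighbourhoods of $p$ in $Z$ contains an open neighbourhood of $p$. -/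

import Mathlib

open scoped Cardinal Topology

/-- The space `ω*`: the Stone-Čech remainder `βω \ ω` of the countable discrete space `ω = ℕ`, with
the subspace topology. -/
abbrev OmegaStar : Type :=
  ((Set.range (stoneCechUnit : ℕ → StoneCech ℕ))ᶜ : Set (StoneCech ℕ))

/-- `e : X → Z` is a compactification of `X`: the space `Z` is compact Hausdorff and `e` is a
homeomorphism of `X` onto a dense subspace of `Z`. -/
structure IsCompactification {X Z : Type*} [TopologicalSpace X] [TopologicalSpace Z]
    (e : X → Z) : Prop where
  compactSpace : CompactSpace Z
  t2Space : T2Space Z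
  isEmbedding : Topology.IsEmbedding e
  denseRange : DenseRange e

/-- The remainder `Z \ X` of a compactification `e : X → Z`. -/
def remainder {X Z : Type*} (e : X → Z) : Set Z :=
  (Set.range e)ᶜ

/-- A finite compactification is a compactification with finite remainder. -/
structure IsFiniteCompactification {X Z : Type*} [TopologicalSpace X] [TopologicalSpace Z]
    (e : X → Z) : Prop extends IsCompactification e where
  finite_remainder : (remainder e).Finite

/-- A point `p` is a `P`-point if every countable intersection of neighbourhoods of `p` contains
again an open neighbourhood of `p`. -/
def IsPPoint {Z : Type*} [TopologicalSpace Z] (p : Z) : Prop :=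
  ∀ S : Set (Set Z), S.Countable → (∀ U ∈ S, U ∈ 𝓝 p) →
    ∃ V : Set Z, IsOpen V ∧ p ∈ V ∧ V ⊆ ⋂₀ S

/-! Under the continuum hypothesis, Parovičenko's theorem says that `ω*` is determined by its clopen
algebra being a Parovičenko algebra (`IsParovicenkoAlgebra`) with at most `𝔠` elements. Two such
algebras are isomorphic by a back-and-forth argument of length `ω₁`
(`IsParovicenkoAlgebra.nonempty_orderIso`), and Stone duality turns the isomorphism into a
homeomorphism. So it suffices to show that the clopen algebra of a finite compactification `Z` of
`ω* \ {x}` is a Parovičenko algebra.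

Clopen sets of `Z` that miss the remainder are the same as clopen sets of `ω*` that miss `x`. If two
countable families of such sets are disjoint from each other, a clopen set `c` of `ω*` separates
them, and `x` lies outside `c` or outside its complement; hence one of the two families is covered
by a clopen set that misses the remainder and the other family
(`IsFiniteCompactification.exists_separation`). This gives all that is needed at the remainder: the
separation property; that no remainder point is a `Gδ`, so that nonempty `Gδ` sets of `Z` meet
`ω* \ {x}` and have nonempty interior; and that there are no two remainder points which fail to be
`P`-points, because each of them would be accumulated by such a family, and the two families can be
taken disjoint from each other. -/

open TopologicalSpace

/-! ### Parovičenko algebras and the back-and-forth argument -/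

/-- The algebraic properties of the clopen algebra of a Parovičenko space: the Boolean algebra is
nontrivial and atomless, any two countable families that are disjoint from each other are separated
by an element, and any countable family of nonzero elements which is closed under finite meets has a
nonzero lower bound. -/
structure IsParovicenkoAlgebra (A : Type*) [BooleanAlgebra A] : Prop where
  bot_ne_top : (⊥ : A) ≠ ⊤
  atomless : ∀ a : A, a ≠ ⊥ → ∃ b, b ≠ ⊥ ∧ b ≤ a ∧ a \ b ≠ ⊥
  separation : ∀ U V : Set A, U.Countable → V.Countable → (∀ u ∈ U, ∀ v ∈ V, Disjoint u v) →
    ∃ c, (∀ u ∈ U, u ≤ c) ∧ ∀ v ∈ V, Disjoint v c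
  lower_bound : ∀ D : Set A, D.Countable → D.Nonempty → InfClosed D → ⊥ ∉ D →
    ∃ b, b ≠ ⊥ ∧ ∀ d ∈ D, b ≤ d

namespace IsParovicenkoAlgebra

variable {A : Type*} [BooleanAlgebra A]

theorem exists_disjoint_pair (h : IsParovicenkoAlgebra A) {x y : A} (hx : x ≠ ⊥) (hy : y ≠ ⊥) :
    ∃ x' y', x' ≠ ⊥ ∧ x' ≤ x ∧ y' ≠ ⊥ ∧ y' ≤ y ∧ Disjoint x' y' := by
  by_cases h1 : x \ y = ⊥
  · obtain ⟨b, hb, hbx, hxb⟩ := h.atomless x hx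
    exact ⟨b, x \ b, hb, hbx, hxb, sdiff_le.trans (sdiff_eq_bot_iff.1 h1), disjoint_sdiff_self_right⟩
  · exact ⟨x \ y, y, h1, sdiff_le, hy, le_rfl, disjoint_sdiff_self_left⟩

/-- Countably many nonzero elements have a disjoint refinement: pairs of indices are made disjoint
one after another, and the resulting decreasing sequences have nonzero lower bounds. -/
theorem exists_disjoint_refinement (h : IsParovicenkoAlgebra A) {ι : Type*} [Countable ι]
    (e : ι → A) (he : ∀ i, e i ≠ ⊥) :
    ∃ d : ι → A, (∀ i, d i ≠ ⊥ ∧ d i ≤ e i) ∧ ∀ i j, i ≠ j → Disjoint (d i) (d j) := by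
  classical
  have step : ∀ (w : {w : ι → A // ∀ i, w i ≠ ⊥}) (p : ι × ι),
      ∃ w' : {w : ι → A // ∀ i, w i ≠ ⊥}, (∀ i, w'.1 i ≤ w.1 i) ∧
        (p.1 ≠ p.2 → Disjoint (w'.1 p.1) (w'.1 p.2)) := by
    rintro ⟨w, hw⟩ ⟨i, j⟩
    obtain ⟨x, y, hx, hxi, hy, hyj, hxy⟩ := h.exists_disjoint_pair (hw i) (hw j)
    by_cases hij : i = j
    · exact ⟨⟨w, hw⟩, fun _ => le_rfl, fun hne => absurd hij hne⟩
    refine ⟨⟨Function.update (Function.update w i x) j y, fun k => ?_⟩, fun k => ?_, fun _ => ?_⟩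
    · by_cases hkj : k = j
      · subst hkj; simpa using hy
      · by_cases hki : k = i
        · subst hki; simpa [hkj] using hx
        · simpa [hkj, hki] using hw k
    · by_cases hkj : k = j
      · subst hkj; simpa using hyj
      · by_cases hki : k = i
        · subst hki; simpa [hkj] using hxi
        · simp [hkj, hki]
    · simpa [hij] using hxy
  rcases isEmpty_or_nonempty ι with hι | hι
  · exact ⟨e, fun i => hι.elim i, fun i => hι.elim i⟩
  choose F hF1 hF2 using step
  obtain ⟨q, hq⟩ := exists_surjective_nat (ι × ι)
  let W : ℕ → {w : ι → A // ∀ i, w i ≠ ⊥} := fun n => Nat.rec ⟨e, he⟩ (fun n w => F w (q n)) n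
  have hW : ∀ i, Antitone fun n => (W n).1 i := fun i =>
    antitone_nat_of_succ_le fun n => hF1 (W n) (q n) i
  have hlow : ∀ i, ∃ b, b ≠ ⊥ ∧ ∀ n, b ≤ (W n).1 i := by
    intro i
    obtain ⟨b, hb, hbW⟩ := h.lower_bound (Set.range fun n => (W n).1 i) (Set.countable_range _)
      (Set.range_nonempty _) (by
        rintro _ ⟨m, rfl⟩ _ ⟨n, rfl⟩
        rcases le_total m n with hmn | hmn
        · exact ⟨n, (inf_eq_right.2 (hW i hmn)).symm⟩
        · exact ⟨m, (inf_eq_left.2 (hW i hmn)).symm⟩)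
      (by rintro ⟨n, hn⟩; exact (W n).2 i hn)
    exact ⟨b, hb, fun n => hbW _ ⟨n, rfl⟩⟩
  choose d hd hdW using hlow
  refine ⟨d, fun i => ⟨hd i, hdW i 0⟩, fun i j hij => ?_⟩
  obtain ⟨n, hn⟩ := hq (i, j)
  have := hF2 (W n) (q n)
  rw [hn] at this
  exact (this hij).mono ((hdW i (n + 1)).trans_eq (by simp only [W, hn]))
    ((hdW j (n + 1)).trans_eq (by simp only [W, hn]))

end IsParovicenkoAlgebra

/-- A Boolean subalgebra `S` of `A × B` that is the graph of an isomorphism between a subalgebra of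
`A` and a subalgebra of `B`; for a subalgebra, this only has to be tested at `⊥`. -/
structure IsPartialIso {A B : Type*} [BooleanAlgebra A] [BooleanAlgebra B] (S : Set (A × B)) :
    Prop where
  bot_mem : ⊥ ∈ S
  sup_mem : ∀ p ∈ S, ∀ q ∈ S, p ⊔ q ∈ S
  compl_mem : ∀ p ∈ S, pᶜ ∈ S
  fst_eq_bot_iff : ∀ p ∈ S, p.1 = ⊥ ↔ p.2 = ⊥

namespace IsPartialIso

variable {A B : Type*} [BooleanAlgebra A] [BooleanAlgebra B] {S : Set (A × B)}

theorem inf_mem (hS : IsPartialIso S) {p q : A × B} (hp : p ∈ S) (hq : q ∈ S) : p ⊓ q ∈ S := by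
  have := hS.compl_mem _ (hS.sup_mem _ (hS.compl_mem _ hp) _ (hS.compl_mem _ hq))
  rwa [compl_sup, compl_compl, compl_compl] at this

theorem sdiff_mem (hS : IsPartialIso S) {p q : A × B} (hp : p ∈ S) (hq : q ∈ S) : p \ q ∈ S := by
  rw [sdiff_eq]
  exact hS.inf_mem hp (hS.compl_mem _ hq)

theorem le_iff (hS : IsPartialIso S) {p q : A × B} (hp : p ∈ S) (hq : q ∈ S) :
    p.1 ≤ q.1 ↔ p.2 ≤ q.2 := by
  rw [← sdiff_eq_bot_iff, ← sdiff_eq_bot_iff]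
  exact hS.fst_eq_bot_iff _ (hS.sdiff_mem hp hq)

theorem swap (hS : IsPartialIso S) : IsPartialIso (Prod.swap ⁻¹' S : Set (B × A)) where
  bot_mem := hS.bot_mem
  sup_mem _ hp _ hq := hS.sup_mem _ hp _ hq
  compl_mem _ hp := hS.compl_mem _ hp
  fst_eq_bot_iff _ hp := (hS.fst_eq_bot_iff _ hp).symm

theorem bot_top (hA : (⊥ : A) ≠ ⊤) (hB : (⊥ : B) ≠ ⊤) : IsPartialIso ({⊥, ⊤} : Set (A × B)) where
  bot_mem := by simp
  sup_mem := by rintro _ (rfl | rfl) _ (rfl | rfl) <;> simp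
  compl_mem := by rintro _ (rfl | rfl) <;> simp
  fst_eq_bot_iff := by rintro _ (rfl | rfl) <;> simp [hA.symm, hB.symm]

theorem of_directed {T : Set (A × B)} (hbot : ⊥ ∈ T)
    (h : ∀ p ∈ T, ∀ q ∈ T, ∃ G ⊆ T, IsPartialIso G ∧ p ∈ G ∧ q ∈ G) : IsPartialIso T where
  bot_mem := hbot
  sup_mem p hp q hq := by
    obtain ⟨G, hGT, hG, hpG, hqG⟩ := h p hp q hq
    exact hGT (hG.sup_mem _ hpG _ hqG)
  compl_mem p hp := by
    obtain ⟨G, hGT, hG, hpG, -⟩ := h p hp p hp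
    exact hGT (hG.compl_mem _ hpG)
  fst_eq_bot_iff p hp := by
    obtain ⟨G, hGT, hG, hpG, -⟩ := h p hp p hp
    exact hG.fst_eq_bot_iff _ hpG

end IsPartialIso

/-- The Boolean subalgebra generated by a Boolean subalgebra `S` and an element `p`. -/
def adjoinElement {C : Type*} [BooleanAlgebra C] (S : Set C) (p : C) : Set C :=
  {q | ∃ s ∈ S, ∃ t ∈ S, q = (s ⊓ p) ⊔ (t ⊓ pᶜ)}

theorem Set.Countable.adjoinElement {C : Type*} [BooleanAlgebra C] {S : Set C} (hS : S.Countable)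
    (p : C) : (adjoinElement S p).Countable := by
  refine ((hS.prod hS).image fun x : C × C => (x.1 ⊓ p) ⊔ (x.2 ⊓ pᶜ)).mono ?_
  rintro q ⟨s, hs, t, ht, rfl⟩
  exact ⟨(s, t), ⟨hs, ht⟩, rfl⟩

theorem compl_inf_sup_inf_compl {C : Type*} [BooleanAlgebra C] (s t p : C) :
    ((s ⊓ p) ⊔ (t ⊓ pᶜ))ᶜ = (sᶜ ⊓ p) ⊔ (tᶜ ⊓ pᶜ) := by
  symm
  apply IsCompl.eq_compl
  have h1 : Disjoint p pᶜ := disjoint_compl_right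
  constructor
  · simp only [disjoint_sup_left, disjoint_sup_right]
    exact ⟨⟨(disjoint_compl_left (a := s)).mono inf_le_left inf_le_left,
      h1.symm.mono inf_le_right inf_le_right⟩,
      ⟨h1.mono inf_le_right inf_le_right, (disjoint_compl_left (a := t)).mono inf_le_left inf_le_left⟩⟩
  · rw [codisjoint_iff]
    calc (sᶜ ⊓ p) ⊔ (tᶜ ⊓ pᶜ) ⊔ ((s ⊓ p) ⊔ (t ⊓ pᶜ))
        = ((sᶜ ⊔ s) ⊓ p) ⊔ ((tᶜ ⊔ t) ⊓ pᶜ) := by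
          rw [inf_sup_right, inf_sup_right]; exact sup_sup_sup_comm _ _ _ _
      _ = ⊤ := by simp

namespace IsPartialIso

variable {A B : Type*} [BooleanAlgebra A] [BooleanAlgebra B] {S : Set (A × B)}

theorem subset_adjoinElement (p : A × B) : S ⊆ adjoinElement S p := fun s hs =>
  ⟨s, hs, s, hs, by rw [← inf_sup_left, sup_compl_eq_top, inf_top_eq]⟩

theorem mem_adjoinElement (hS : IsPartialIso S) (p : A × B) : p ∈ adjoinElement S p :=
  ⟨⊤, by simpa using hS.compl_mem _ hS.bot_mem, ⊥, hS.bot_mem, by simp⟩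

theorem adjoinElement (hS : IsPartialIso S) {a : A} {b : B}
    (h1 : ∀ s ∈ S, s.1 ⊓ a = ⊥ ↔ s.2 ⊓ b = ⊥) (h2 : ∀ s ∈ S, s.1 ⊓ aᶜ = ⊥ ↔ s.2 ⊓ bᶜ = ⊥) :
    IsPartialIso (adjoinElement S (a, b)) where
  bot_mem := subset_adjoinElement _ hS.bot_mem
  sup_mem := by
    rintro _ ⟨s, hs, t, ht, rfl⟩ _ ⟨s', hs', t', ht', rfl⟩
    refine ⟨s ⊔ s', hS.sup_mem _ hs _ hs', t ⊔ t', hS.sup_mem _ ht _ ht', ?_⟩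
    rw [inf_sup_right, inf_sup_right]
    exact sup_sup_sup_comm _ _ _ _
  compl_mem := by
    rintro _ ⟨s, hs, t, ht, rfl⟩
    exact ⟨sᶜ, hS.compl_mem _ hs, tᶜ, hS.compl_mem _ ht, compl_inf_sup_inf_compl _ _ _⟩
  fst_eq_bot_iff := by
    rintro _ ⟨s, hs, t, ht, rfl⟩
    simp only [Prod.fst_sup, Prod.snd_sup, Prod.fst_inf, Prod.snd_inf, sup_eq_bot_iff]
    exact and_congr (h1 s hs) (h2 t ht)

/-- If `t` is the image of an `s` that meets `a`, then `t` contains a nonzero element which is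
disjoint from the images of all elements disjoint from `a`. -/
theorem exists_disjoint_image (hB : IsParovicenkoAlgebra B) (hS : IsPartialIso S)
    (hc : S.Countable) (a : A) {s : A × B} (hs : s ∈ S) (hsa : s.1 ⊓ a ≠ ⊥) :
    ∃ d : B, d ≠ ⊥ ∧ d ≤ s.2 ∧ ∀ t ∈ S, Disjoint t.1 a → Disjoint t.2 d := by
  obtain ⟨d, hd, hle⟩ := hB.lower_bound
    ((fun t : A × B => s.2 \ t.2) '' {t ∈ S | Disjoint t.1 a})
    ((hc.mono (Set.sep_subset _ _)).image _) ⟨_, ⊥, ⟨hS.bot_mem, disjoint_bot_left⟩, rfl⟩ (by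
      rintro _ ⟨t, ⟨ht, hta⟩, rfl⟩ _ ⟨t', ⟨ht', hta'⟩, rfl⟩
      exact ⟨t ⊔ t', ⟨hS.sup_mem _ ht _ ht', Disjoint.sup_left hta hta'⟩, sdiff_sup⟩) (by
      rintro ⟨t, ⟨ht, hta⟩, h⟩
      have hle : s.1 ≤ t.1 := (hS.le_iff hs ht).2 (sdiff_eq_bot_iff.1 h)
      exact hsa (disjoint_iff.1 (hta.mono_left hle)))
  refine ⟨d, hd, ?_, fun t ht hta => ?_⟩
  · exact (hle _ ⟨⊥, ⟨hS.bot_mem, disjoint_bot_left⟩, rfl⟩).trans sdiff_le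
  · exact (disjoint_sdiff_self_right).mono_right (hle _ ⟨t, ⟨ht, hta⟩, rfl⟩)

/-- A countable partial isomorphism into a Parovičenko algebra can be extended to any further
element `a`. The image `b` of `a` has to lie above the images of the elements below `a`, to be
disjoint from the images of the elements disjoint from `a`, and to cut every image which `a` cuts;
the last condition is enforced by means of a disjoint refinement. -/
theorem exists_extension (hB : IsParovicenkoAlgebra B) (hS : IsPartialIso S) (hc : S.Countable)
    (a : A) : ∃ b : B, IsPartialIso (_root_.adjoinElement S (a, b)) := by
  have : Countable S := hc.to_subtype
  have hK : ∀ k : {s : S // s.1.1 ⊓ a ≠ ⊥} ⊕ {s : S // s.1.1 ⊓ aᶜ ≠ ⊥}, ∃ d : B, d ≠ ⊥ ∧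
      Sum.elim (fun s => d ≤ s.1.1.2 ∧ ∀ t ∈ S, Disjoint t.1 a → Disjoint t.2 d)
        (fun s => d ≤ s.1.1.2 ∧ ∀ t ∈ S, Disjoint t.1 aᶜ → Disjoint t.2 d) k := by
    rintro (s | s)
    · exact exists_disjoint_image hB hS hc a s.1.2 s.2
    · exact exists_disjoint_image hB hS hc aᶜ s.1.2 s.2
  choose e he heK using hK
  obtain ⟨d, hd, hdd⟩ := hB.exists_disjoint_refinement e he
  obtain ⟨b, hbU, hbV⟩ := hB.separation
    (Prod.snd '' {t ∈ S | Disjoint t.1 aᶜ} ∪ Set.range fun s => d (Sum.inl s))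
    (Prod.snd '' {t ∈ S | Disjoint t.1 a} ∪ Set.range fun s => d (Sum.inr s))
    (((hc.mono (Set.sep_subset _ _)).image _).union (Set.countable_range _))
    (((hc.mono (Set.sep_subset _ _)).image _).union (Set.countable_range _)) (by
      rintro _ (⟨t, ⟨ht, hta⟩, rfl⟩ | ⟨s, rfl⟩) _ (⟨t', ⟨ht', hta'⟩, rfl⟩ | ⟨s', rfl⟩)
      · have : t.1 ⊓ t'.1 = ⊥ := disjoint_iff.1
          (disjoint_compl_right.mono (disjoint_compl_right_iff.1 hta) hta'.le_compl_right)
        exact disjoint_iff.2 ((hS.fst_eq_bot_iff _ (hS.inf_mem ht ht')).1 this)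
      · exact ((heK (Sum.inr s')).2 t ht hta).mono_right (hd _).2
      · exact (((heK (Sum.inl s)).2 t' ht' hta').mono_right (hd _).2).symm
      · exact hdd _ _ (by simp))
  refine ⟨b, hS.adjoinElement (fun s hs => ⟨fun h => ?_, fun h => ?_⟩)
    fun s hs => ⟨fun h => ?_, fun h => ?_⟩⟩
  · exact disjoint_iff.1 (hbV _ (Or.inl ⟨s, ⟨hs, disjoint_iff.2 h⟩, rfl⟩))
  · by_contra hne
    refine (hd (Sum.inl ⟨⟨s, hs⟩, hne⟩)).1 (le_bot_iff.1 ?_)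
    rw [← h]
    exact le_inf ((hd _).2.trans (heK (Sum.inl ⟨⟨s, hs⟩, hne⟩)).1) (hbU _ (Or.inr ⟨_, rfl⟩))
  · exact disjoint_iff.1 (disjoint_compl_right_iff.2
      (hbU _ (Or.inl ⟨s, ⟨hs, disjoint_iff.2 h⟩, rfl⟩)))
  · by_contra hne
    refine (hd (Sum.inr ⟨⟨s, hs⟩, hne⟩)).1 (le_bot_iff.1 ?_)
    rw [← h]
    exact le_inf ((hd _).2.trans (heK (Sum.inr ⟨⟨s, hs⟩, hne⟩)).1)
      (hbV _ (Or.inr ⟨_, rfl⟩)).le_compl_right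

/-- A step of the back-and-forth construction. -/
theorem exists_extension_both (hA : IsParovicenkoAlgebra A) (hB : IsParovicenkoAlgebra B)
    (hS : IsPartialIso S) (hc : S.Countable) (a : A) (b : B) :
    ∃ T, S ⊆ T ∧ IsPartialIso T ∧ T.Countable ∧ (∃ b', (a, b') ∈ T) ∧ ∃ a', (a', b) ∈ T := by
  obtain ⟨b', hb'⟩ := exists_extension hB hS hc a
  have hc' := hc.adjoinElement (a, b')
  have hinj : Function.Injective (Prod.swap : B × A → A × B) := Prod.swap_injective
  obtain ⟨a', ha'⟩ := exists_extension hA hb'.swap (hc'.preimage hinj) b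
  refine ⟨Prod.swap ⁻¹' _, ?_, ha'.swap, ((hc'.preimage hinj).adjoinElement _).preimage
    Prod.swap_injective, ⟨b', ?_⟩, a', ?_⟩
  · intro s hs
    exact subset_adjoinElement (b, a') (show s.swap ∈ _ from subset_adjoinElement (a, b') hs)
  · exact subset_adjoinElement (b, a') (show (b', a) ∈ _ from hS.mem_adjoinElement (a, b'))
  · exact hb'.swap.mem_adjoinElement (b, a')

end IsPartialIso

/-- Under the continuum hypothesis, two Parovičenko algebras of cardinality at most `𝔠` are
isomorphic: the isomorphism is built by back-and-forth along a well-order of `Set ℕ` all of whose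
initial segments are countable. -/
theorem IsParovicenkoAlgebra.nonempty_orderIso (hCH : (ℵ₁ : Cardinal.{0}) = 𝔠)
    {A B : Type*} [BooleanAlgebra A] [BooleanAlgebra B]
    (hA : IsParovicenkoAlgebra A) (hB : IsParovicenkoAlgebra B)
    {f : Set ℕ → A} (hf : Function.Surjective f) {g : Set ℕ → B} (hg : Function.Surjective g) :
    Nonempty (A ≃o B) := by
  obtain ⟨r, wo, hr⟩ := Cardinal.exists_ord_eq (Set ℕ)
  have hcount : ∀ i, {j | r j i}.Countable := by
    intro i
    rw [← Cardinal.le_aleph0_iff_set_countable, ← Cardinal.lt_aleph_one_iff, hCH]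
    have h1 := Cardinal.card_typein_lt i hr
    have h2 : #(Set ℕ) = 𝔠 := by simp
    rw [h2] at h1
    exact h1
  have hstep : ∀ (i : Set ℕ) (T : Set (A × B)), ∃ T', T ⊆ T' ∧ (IsPartialIso T → T.Countable →
      IsPartialIso T' ∧ T'.Countable ∧ (∃ b, (f i, b) ∈ T') ∧ ∃ a, (a, g i) ∈ T') := by
    intro i T
    by_cases h : IsPartialIso T ∧ T.Countable
    · obtain ⟨T', h1, h2⟩ := IsPartialIso.exists_extension_both hA hB h.1 h.2 (f i) (g i)
      exact ⟨T', h1, fun _ _ => h2⟩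
    · exact ⟨T, le_rfl, fun h1 h2 => absurd ⟨h1, h2⟩ h⟩
  choose E hE1 hE2 using hstep
  let Q : Set ℕ → Set (A × B) := (wo.wf).fix fun i rec => E i ({⊥, ⊤} ∪ ⋃ j, ⋃ h : r j i, rec j h)
  have hQ : ∀ i, Q i = E i ({⊥, ⊤} ∪ ⋃ j, ⋃ _ : r j i, Q j) := fun i => wo.wf.fix_eq _ i
  have hQbt : ∀ i, {⊥, ⊤} ⊆ Q i := fun i => by
    rw [hQ i]; exact Set.subset_union_left.trans (hE1 i _)
  have hQmono : ∀ i j, r j i → Q j ⊆ Q i := fun i j h => by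
    rw [hQ i]
    exact (Set.subset_iUnion₂ (s := fun j (_ : r j i) => Q j) j h).trans
      (Set.subset_union_right.trans (hE1 i _))
  -- a union of any stages, together with the trivial partial isomorphism
  have hunion : ∀ s : Set (Set ℕ), (∀ j ∈ s, IsPartialIso (Q j)) →
      IsPartialIso ({⊥, ⊤} ∪ ⋃ j, ⋃ _ : j ∈ s, Q j) := by
    intro s hs
    refine IsPartialIso.of_directed (by simp) ?_
    have hsub : ∀ j ∈ s, Q j ⊆ {⊥, ⊤} ∪ ⋃ j, ⋃ _ : j ∈ s, Q j := fun j hj =>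
      (Set.subset_iUnion₂ (s := fun j (_ : j ∈ s) => Q j) j hj).trans Set.subset_union_right
    intro p hp q hq
    rcases hp with hp | hp <;> rcases hq with hq | hq
    · exact ⟨_, Set.subset_union_left, IsPartialIso.bot_top hA.bot_ne_top hB.bot_ne_top, hp, hq⟩
    · obtain ⟨j, hj, hqj⟩ := Set.mem_iUnion₂.1 hq
      exact ⟨_, hsub j hj, hs j hj, hQbt j hp, hqj⟩
    · obtain ⟨j, hj, hpj⟩ := Set.mem_iUnion₂.1 hp
      exact ⟨_, hsub j hj, hs j hj, hpj, hQbt j hq⟩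
    · obtain ⟨j, hj, hpj⟩ := Set.mem_iUnion₂.1 hp
      obtain ⟨k, hk, hqk⟩ := Set.mem_iUnion₂.1 hq
      rcases trichotomous_of r j k with h | h | h
      · exact ⟨_, hsub k hk, hs k hk, hQmono _ _ h hpj, hqk⟩
      · subst h; exact ⟨_, hsub j hj, hs j hj, hpj, hqk⟩
      · exact ⟨_, hsub j hj, hs j hj, hpj, hQmono _ _ h hqk⟩
  have hgood : ∀ i, (IsPartialIso (Q i) ∧ (Q i).Countable ∧
      (∃ b, (f i, b) ∈ Q i) ∧ ∃ a, (a, g i) ∈ Q i) := by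
    intro i
    induction i using wo.wf.induction with
    | _ i ih =>
      rw [hQ i]
      refine hE2 i _ (hunion {j | r j i} fun j hj => (ih j hj).1) ?_
      refine (Set.Finite.countable (by simp)).union ?_
      exact (hcount i).biUnion fun j hj => (ih j hj).2.1
  have hT := hunion Set.univ fun j _ => (hgood j).1
  set T : Set (A × B) := {⊥, ⊤} ∪ ⋃ j, ⋃ _ : j ∈ Set.univ, Q j with hTdef
  have hQT : ∀ j, Q j ⊆ T := fun j =>
    (Set.subset_iUnion₂ (s := fun j (_ : j ∈ Set.univ) => Q j) j trivial).trans
      Set.subset_union_right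
  have hF : ∀ a, ∃ b, (a, b) ∈ T := fun a => by
    obtain ⟨i, rfl⟩ := hf a
    obtain ⟨b, hb⟩ := (hgood i).2.2.1
    exact ⟨b, hQT i hb⟩
  have hG : ∀ b, ∃ a, (a, b) ∈ T := fun b => by
    obtain ⟨i, rfl⟩ := hg b
    obtain ⟨a, ha⟩ := (hgood i).2.2.2
    exact ⟨a, hQT i ha⟩
  choose F hF using hF
  choose G hG using hG
  exact ⟨{ toFun := F
           invFun := G
           left_inv := fun a => le_antisymm ((hT.le_iff (hG (F a)) (hF a)).2 le_rfl)
             ((hT.le_iff (hF a) (hG (F a))).2 le_rfl)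
           right_inv := fun b => le_antisymm ((hT.le_iff (hF (G b)) (hG b)).1 le_rfl)
             ((hT.le_iff (hG b) (hF (G b))).1 le_rfl)
           map_rel_iff' := fun {a a'} => (hT.le_iff (hF a) (hF a')).symm }⟩

/-! ### Stone duality -/

theorem exists_clopens_mem_subset {X : Type*} [TopologicalSpace X] [CompactSpace X] [T2Space X]
    [TotallyDisconnectedSpace X] {x : X} {N : Set X} (hN : N ∈ 𝓝 x) :
    ∃ C : Clopens X, x ∈ C ∧ (C : Set X) ⊆ N := by
  obtain ⟨U, hUN, hU, hxU⟩ := mem_nhds_iff.1 hN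
  obtain ⟨V, hV, hxV, hVU⟩ := compact_exists_isClopen_in_isOpen hU hxU
  exact ⟨⟨V, hV⟩, hxV, hVU.trans hUN⟩

theorem eq_of_forall_mem_clopens {X : Type*} [TopologicalSpace X] [CompactSpace X] [T2Space X]
    [TotallyDisconnectedSpace X] {x y : X} (h : ∀ C : Clopens X, x ∈ C → y ∈ C) : x = y := by
  by_contra hne
  obtain ⟨C, hxC, hC⟩ := exists_clopens_mem_subset (isOpen_compl_singleton.mem_nhds hne)
  exact hC (h C hxC) rfl

/-- Compactness: a filter base of nonempty clopen sets has a common point. -/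
theorem exists_forall_mem_clopens {X : Type*} [TopologicalSpace X] [CompactSpace X]
    {D : Set (Clopens X)} (hne : D.Nonempty) (hD : InfClosed D) (hbot : ⊥ ∉ D) :
    ∃ x : X, ∀ d ∈ D, x ∈ d := by
  have : Nonempty ((fun d : Clopens X => (d : Set X)) '' D) := (hne.image _).to_subtype
  obtain ⟨x, hx⟩ := IsCompact.nonempty_sInter_of_directed_nonempty_isCompact_isClosed
    (S := (fun d : Clopens X => (d : Set X)) '' D) (by
      rintro _ ⟨d, hd, rfl⟩ _ ⟨d', hd', rfl⟩
      exact ⟨_, ⟨d ⊓ d', hD hd hd', rfl⟩, Set.inter_subset_left, Set.inter_subset_right⟩) (by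
      rintro _ ⟨d, hd, rfl⟩
      rw [Set.nonempty_iff_ne_empty]
      intro h
      exact hbot ((Clopens.ext h : d = ⊥) ▸ hd))
    (by rintro _ ⟨d, hd, rfl⟩; exact d.isClosed.isCompact)
    (by rintro _ ⟨d, hd, rfl⟩; exact d.isClosed)
  exact ⟨x, fun d hd => hx _ ⟨d, hd, rfl⟩⟩

theorem exists_continuous_of_clopens_orderIso {X Y : Type*} [TopologicalSpace X]
    [TopologicalSpace Y] [CompactSpace Y] [T2Space Y] [TotallyDisconnectedSpace Y]
    (φ : Clopens X ≃o Clopens Y) :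
    ∃ f : X → Y, Continuous f ∧ ∀ x C, f x ∈ φ C ↔ x ∈ C := by
  have key : ∀ x : X, ∃ y : Y, ∀ C, y ∈ φ C ↔ x ∈ C := by
    intro x
    obtain ⟨y, hy⟩ := exists_forall_mem_clopens (D := φ '' {C | x ∈ C}) ⟨_, ⊤, trivial, rfl⟩ (by
      rintro _ ⟨C, hC, rfl⟩ _ ⟨C', hC', rfl⟩
      exact ⟨C ⊓ C', ⟨hC, hC'⟩, map_inf φ C C'⟩) (by
      rintro ⟨C, hC, h⟩
      rw [map_eq_bot_iff] at h
      subst h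
      exact hC)
    refine ⟨y, fun C => ⟨fun h => ?_, fun h => hy _ ⟨C, h, rfl⟩⟩⟩
    by_contra hx
    have h' : y ∈ φ Cᶜ := hy _ ⟨Cᶜ, hx, rfl⟩
    rw [map_compl] at h'
    exact h' h
  choose f hf using key
  refine ⟨f, ?_, hf⟩
  rw [isTopologicalBasis_isClopen.continuous_iff]
  intro V hV
  have : f ⁻¹' V = φ.symm ⟨V, hV⟩ := by
    ext x
    have := hf x (φ.symm ⟨V, hV⟩)
    rw [OrderIso.apply_symm_apply] at this
    exact this
  rw [this]
  exact (φ.symm ⟨V, hV⟩).isOpen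

theorem nonempty_homeomorph_of_clopens_orderIso {X Y : Type*} [TopologicalSpace X] [CompactSpace X]
    [T2Space X] [TotallyDisconnectedSpace X] [TopologicalSpace Y] [CompactSpace Y] [T2Space Y]
    [TotallyDisconnectedSpace Y] (φ : Clopens X ≃o Clopens Y) : Nonempty (X ≃ₜ Y) := by
  obtain ⟨f, hfc, hf⟩ := exists_continuous_of_clopens_orderIso φ
  obtain ⟨g, hgc, hg⟩ := exists_continuous_of_clopens_orderIso φ.symm
  refine ⟨⟨⟨f, g, fun x => ?_, fun y => ?_⟩, hfc, hgc⟩⟩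
  · refine (eq_of_forall_mem_clopens fun C hC => ?_).symm
    have := (hg (f x) (φ C)).2 ((hf x C).2 hC)
    rwa [OrderIso.symm_apply_apply] at this
  · refine (eq_of_forall_mem_clopens fun C hC => ?_).symm
    have := (hf (g y) (φ.symm C)).2 ((hg y C).2 hC)
    rwa [OrderIso.apply_symm_apply] at this

/-! ### The clopen algebra of `ω*` -/

instance : ExtremallyDisconnected (StoneCech ℕ) :=
  StoneCech.projective.extremallyDisconnected

theorem exists_isClopen_stoneCech_nat (A : Set ℕ) : ∃ C : Set (StoneCech ℕ), IsClopen C ∧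
    ∀ n, stoneCechUnit n ∈ C ↔ n ∈ A := by
  classical
  have hc : Continuous fun k : ℕ => decide (k ∈ A) := continuous_of_discreteTopology
  refine ⟨stoneCechExtend hc ⁻¹' {true},
    (isClopen_discrete _).preimage (continuous_stoneCechExtend hc), fun n => ?_⟩
  simp

theorem isClopen_eq_closure {C : Set (StoneCech ℕ)} (hC : IsClopen C) :
    C = closure (stoneCechUnit '' {n | stoneCechUnit n ∈ C}) := by
  apply subset_antisymm
  · intro y hy
    rw [mem_closure_iff]
    intro U hU hyU
    obtain ⟨_, hn, n, rfl⟩ := denseRange_stoneCechUnit.inter_open_nonempty (U ∩ C)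
      (hU.inter hC.isOpen) ⟨y, hyU, hy⟩
    exact ⟨_, hn.1, n, hn.2, rfl⟩
  · refine closure_minimal ?_ hC.isClosed
    rintro _ ⟨n, hn, rfl⟩
    exact hn

theorem isClopen_closure_image (A : Set ℕ) :
    IsClopen (closure (stoneCechUnit '' A : Set (StoneCech ℕ))) := by
  obtain ⟨C, hC, hCA⟩ := exists_isClopen_stoneCech_nat A
  have := isClopen_eq_closure hC
  simp only [hCA, Set.ofPred_mem_eq] at this
  rwa [← this]

theorem stoneCechUnit_mem_closure_image {A : Set ℕ} {n : ℕ} :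
    (stoneCechUnit n : StoneCech ℕ) ∈ closure (stoneCechUnit '' A) ↔ n ∈ A := by
  obtain ⟨C, hC, hCA⟩ := exists_isClopen_stoneCech_nat A
  have := isClopen_eq_closure hC
  simp only [hCA, Set.ofPred_mem_eq] at this
  rw [← this, hCA]

theorem isOpen_range_stoneCechUnit_nat :
    IsOpen (Set.range (stoneCechUnit : ℕ → StoneCech ℕ)) := by
  rw [← Set.iUnion_singleton_eq_range]
  refine isOpen_iUnion fun n => ?_
  have := isClopen_closure_image {n}
  rw [Set.image_singleton, closure_singleton] at this
  exact this.isOpen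

instance : CompactSpace OmegaStar :=
  isCompact_iff_compactSpace.1 isOpen_range_stoneCechUnit_nat.isClosed_compl.isCompact

/-- The clopen subset `A* = cl(A) \ ω` of `ω*` given by a set `A` of natural numbers. -/
def starClopen (A : Set ℕ) : Clopens OmegaStar :=
  ⟨Subtype.val ⁻¹' closure (stoneCechUnit '' A),
    (isClopen_closure_image A).preimage continuous_subtype_val⟩

theorem mem_starClopen {A : Set ℕ} {y : OmegaStar} :
    y ∈ starClopen A ↔ y.1 ∈ closure (stoneCechUnit '' A) := Iff.rfl

theorem starClopen_sup (A B : Set ℕ) : starClopen A ⊔ starClopen B = starClopen (A ∪ B) := by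
  ext y
  change y ∈ starClopen A ∨ y ∈ starClopen B ↔ y ∈ starClopen (A ∪ B)
  rw [mem_starClopen, mem_starClopen, mem_starClopen, Set.image_union, closure_union]
  rfl

theorem starClopen_compl (A : Set ℕ) : (starClopen A)ᶜ = starClopen Aᶜ := by
  have h : (closure (stoneCechUnit '' A) : Set (StoneCech ℕ))ᶜ = closure (stoneCechUnit '' Aᶜ) := by
    rw [isClopen_eq_closure (isClopen_closure_image A).compl]
    simp only [Set.mem_compl_iff, stoneCechUnit_mem_closure_image]
    rfl
  ext y
  change y.1 ∈ (closure (stoneCechUnit '' A))ᶜ ↔ y ∈ starClopen Aᶜ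
  rw [h]; rfl

theorem starClopen_inf (A B : Set ℕ) : starClopen A ⊓ starClopen B = starClopen (A ∩ B) := by
  rw [← compl_inj_iff, compl_inf, starClopen_compl, starClopen_compl, starClopen_sup,
    starClopen_compl, Set.compl_inter]

theorem starClopen_sdiff (A B : Set ℕ) : starClopen A \ starClopen B = starClopen (A \ B) := by
  rw [sdiff_eq, starClopen_compl, starClopen_inf]; rfl

theorem starClopen_eq_bot_iff {A : Set ℕ} : starClopen A = ⊥ ↔ A.Finite := by
  constructor
  · intro h
    have hsub : closure (stoneCechUnit '' A) ⊆ Set.range (stoneCechUnit : ℕ → StoneCech ℕ) := by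
      intro y hy
      by_contra hy'
      have : (⟨y, hy'⟩ : OmegaStar) ∈ starClopen A := hy
      rw [h] at this
      exact this
    -- a compact subset of the discrete open set `ω` is finite
    obtain ⟨t, ht⟩ := isClosed_closure.isCompact.elim_finite_subcover
      (fun n : ℕ => closure (stoneCechUnit '' {n} : Set (StoneCech ℕ)))
      (fun n => (isClopen_closure_image _).isOpen) (by
        intro y hy
        obtain ⟨n, rfl⟩ := hsub hy
        exact Set.mem_iUnion.2 ⟨n, subset_closure ⟨n, rfl, rfl⟩⟩)
    refine t.finite_toSet.subset fun n hn => ?_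
    obtain ⟨k, hk, hnk⟩ := Set.mem_iUnion₂.1 (ht (stoneCechUnit_mem_closure_image.2 hn))
    rw [stoneCechUnit_mem_closure_image, Set.mem_singleton_iff] at hnk
    exact hnk ▸ hk
  · intro h
    ext y
    change y.1 ∈ closure (stoneCechUnit '' A) ↔ False
    rw [(h.image _).isClosed.closure_eq, iff_false]
    rintro ⟨n, -, hn⟩
    exact y.2 ⟨n, hn⟩

theorem starClopen_le_iff {A B : Set ℕ} : starClopen A ≤ starClopen B ↔ (A \ B).Finite := by
  rw [← sdiff_eq_bot_iff, starClopen_sdiff, starClopen_eq_bot_iff]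

theorem starClopen_disjoint_iff {A B : Set ℕ} :
    Disjoint (starClopen A) (starClopen B) ↔ (A ∩ B).Finite := by
  rw [disjoint_iff, starClopen_inf, starClopen_eq_bot_iff]

theorem starClopen_surjective : Function.Surjective starClopen := by
  intro K
  have hK : IsClosed (Subtype.val '' (K : Set OmegaStar)) :=
    isOpen_range_stoneCechUnit_nat.isClosed_compl.isClosedMap_subtype_val _ K.isClosed
  have hK' : IsClosed (Subtype.val '' ((K : Set OmegaStar)ᶜ)) :=
    isOpen_range_stoneCechUnit_nat.isClosed_compl.isClosedMap_subtype_val _ K.isOpen.isClosed_compl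
  obtain ⟨C, hC, hKC, hCK⟩ := exists_clopen_of_closed_subset_open hK hK'.isOpen_compl (by
    rintro _ ⟨y, hy, rfl⟩ ⟨z, hz, hzy⟩
    exact hz (Subtype.val_injective hzy ▸ hy))
  refine ⟨{n | stoneCechUnit n ∈ C}, ?_⟩
  ext y
  change y.1 ∈ closure (stoneCechUnit '' {n | stoneCechUnit n ∈ C}) ↔ y ∈ K
  rw [← isClopen_eq_closure hC]
  refine ⟨fun h => ?_, fun h => hKC ⟨y, h, rfl⟩⟩
  by_contra hy
  exact hCK h ⟨y, hy, rfl⟩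

/-- The separation property: if all intersections `A m ∩ B n` are finite, then the set
`⋃ n, A n \ (B 0 ∪ ⋯ ∪ B n)` almost contains every `A n` and is almost disjoint from every `B n`. -/
theorem exists_starClopen_separation {A B : ℕ → Set ℕ} (h : ∀ m n, (A m ∩ B n).Finite) :
    ∃ C : Set ℕ, (∀ n, (A n \ C).Finite) ∧ ∀ n, (B n ∩ C).Finite := by
  refine ⟨⋃ n, (A n \ ⋃ m ∈ Set.Iic n, B m), fun n => ?_, fun n => ?_⟩
  · refine ((Set.finite_Iic n).biUnion fun m _ => h n m).subset ?_
    rintro k ⟨hkA, hk⟩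
    rw [Set.mem_iUnion] at hk
    push Not at hk
    have := hk n
    simp only [Set.mem_sdiff, not_and, not_not] at this
    obtain ⟨m, hm, hkm⟩ := Set.mem_iUnion₂.1 (this hkA)
    exact Set.mem_iUnion₂.2 ⟨m, hm, hkA, hkm⟩
  · refine ((Set.finite_Iio n).biUnion fun m _ => h m n).subset ?_
    rintro k ⟨hkB, hk⟩
    obtain ⟨m, hkA, hk⟩ := Set.mem_iUnion.1 hk
    refine Set.mem_iUnion₂.2 ⟨m, ?_, hkA, hkB⟩
    by_contra hmn
    exact hk (Set.mem_iUnion₂.2 ⟨n, Set.mem_Iic.2 (not_lt.1 hmn), hkB⟩)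

/-- A decreasing sequence of infinite sets has an infinite pseudo-intersection. -/
theorem exists_infinite_pseudoIntersection {A : ℕ → Set ℕ} (hA : Antitone A)
    (hinf : ∀ n, (A n).Infinite) : ∃ P : Set ℕ, P.Infinite ∧ ∀ n, (P \ A n).Finite := by
  obtain ⟨φ, hφ, hφA⟩ := Filter.extraction_forall_of_frequently
    (fun n => Nat.frequently_atTop_iff_infinite.2 (hinf n))
  refine ⟨Set.range φ, Set.infinite_range_of_injective hφ.injective, fun n => ?_⟩
  refine ((Set.finite_Iio n).image φ).subset ?_
  rintro _ ⟨⟨k, rfl⟩, hk⟩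
  refine ⟨k, ?_, rfl⟩
  by_contra hkn
  exact hk (hA (not_lt.1 hkn) (hφA k))

theorem isParovicenkoAlgebra_clopens_omegaStar : IsParovicenkoAlgebra (Clopens OmegaStar) where
  bot_ne_top := by
    have h : (⊤ : Clopens OmegaStar) = starClopen Set.univ := by
      rw [← compl_bot, ← starClopen_eq_bot_iff.2 Set.finite_empty, starClopen_compl,
        Set.compl_empty]
    rw [h]
    exact fun h' => Set.infinite_univ (starClopen_eq_bot_iff.1 h'.symm)
  atomless a ha := by
    obtain ⟨A, rfl⟩ := starClopen_surjective a
    rw [Ne, starClopen_eq_bot_iff] at ha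
    obtain ⟨B, C, hBC, hdisj, hcard⟩ :=
      Set.Infinite.exists_union_disjoint_cardinal_eq_of_infinite ha
    have hiff : B.Finite ↔ C.Finite := by
      obtain ⟨f⟩ := Cardinal.eq.1 hcard
      exact f.finite_iff
    subst hBC
    have hB : ¬B.Finite := fun h => ha (h.union (hiff.1 h))
    refine ⟨starClopen B, mt starClopen_eq_bot_iff.1 hB, ?_, ?_⟩
    · rw [← starClopen_sup]
      exact le_sup_left
    · rw [starClopen_sdiff, Set.union_sdiff_cancel_left hdisj.le_bot, Ne, starClopen_eq_bot_iff,
        ← hiff]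
      exact hB
  separation U V hU hV hUV := by
    rcases U.eq_empty_or_nonempty with rfl | hU'
    · exact ⟨⊥, by simp, by simp⟩
    rcases V.eq_empty_or_nonempty with rfl | hV'
    · exact ⟨⊤, by simp, by simp⟩
    obtain ⟨u, rfl⟩ := hU.exists_eq_range hU'
    obtain ⟨v, rfl⟩ := hV.exists_eq_range hV'
    choose s hs using starClopen_surjective
    obtain ⟨C, hC1, hC2⟩ := exists_starClopen_separation (A := s ∘ u) (B := s ∘ v) (fun m n => by
      rw [← starClopen_disjoint_iff, Function.comp_apply, Function.comp_apply, hs, hs]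
      exact hUV _ ⟨m, rfl⟩ _ ⟨n, rfl⟩)
    refine ⟨starClopen C, ?_, ?_⟩
    · rintro _ ⟨n, rfl⟩
      rw [← hs (u n), starClopen_le_iff]
      exact hC1 n
    · rintro _ ⟨n, rfl⟩
      rw [← hs (v n), starClopen_disjoint_iff]
      exact hC2 n
  lower_bound D hD hne hinf hbot := by
    obtain ⟨d, rfl⟩ := hD.exists_eq_range hne
    choose s hs using starClopen_surjective
    have hmem : ∀ n, starClopen (⋂ m ∈ Set.Iic n, s (d m)) ∈ Set.range d := by
      intro n
      induction n with
      | zero => exact ⟨0, by simp [hs]⟩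
      | succ n ih =>
        have := hinf ih ⟨n + 1, rfl⟩
        rw [← hs (d (n + 1)), starClopen_inf] at this
        convert this using 2
        ext k
        simp [Nat.le_succ_iff, or_imp, forall_and]
    obtain ⟨P, hP, hPA⟩ := exists_infinite_pseudoIntersection
      (A := fun n => ⋂ m ∈ Set.Iic n, s (d m))
      (fun m n hmn => Set.biInter_subset_biInter_left (Set.Iic_subset_Iic.2 hmn))
      (fun n hfin => hbot (starClopen_eq_bot_iff.2 hfin ▸ hmem n))
    refine ⟨starClopen P, fun h => hP (starClopen_eq_bot_iff.1 h), ?_⟩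
    rintro _ ⟨n, rfl⟩
    rw [← hs (d n), starClopen_le_iff]
    refine (hPA n).subset (Set.sdiff_subset_sdiff_right ?_)
    exact Set.biInter_subset_of_mem (Set.self_mem_Iic)

/-! ### Clopen sets of a finite compactification -/

namespace IsFiniteCompactification

variable {x : OmegaStar} {Z : Type*} [TopologicalSpace Z] {e : ({x}ᶜ : Set OmegaStar) → Z}

theorem isOpenEmbedding (he : IsFiniteCompactification e) : Topology.IsOpenEmbedding e := by
  have := he.t2Space
  refine ⟨he.isEmbedding, ?_⟩
  have := he.finite_remainder.isClosed.isOpen_compl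
  rwa [remainder, compl_compl] at this

theorem mem_remainder_or {X Z : Type*} {e : X → Z} (z : Z) : z ∈ remainder e ∨ ∃ y, e y = z := by
  by_cases h : ∃ y, e y = z
  · exact Or.inr h
  · exact Or.inl h

end IsFiniteCompactification

/-- The clopen set `C` of the compactification misses the remainder, and the clopen set `K` of `ω*`
is the same set, viewed in `ω*` (where it misses `x`). -/
structure ClopensCorrespond {x : OmegaStar} {Z : Type*} [TopologicalSpace Z]
    (e : ({x}ᶜ : Set OmegaStar) → Z) (C : Clopens Z) (K : Clopens OmegaStar) : Prop where
  disjoint : Disjoint (C : Set Z) (remainder e)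
  notMem : x ∉ K
  mem_iff : ∀ y, e y ∈ C ↔ y.1 ∈ K

namespace ClopensCorrespond

variable {x : OmegaStar} {Z : Type*} [TopologicalSpace Z] {e : ({x}ᶜ : Set OmegaStar) → Z}
  {C C' : Clopens Z} {K K' : Clopens OmegaStar}

theorem exists_eq_of_mem (h : ClopensCorrespond e C K) {z : Z} (hz : z ∈ C) :
    ∃ y, e y = z ∧ y.1 ∈ K := by
  rcases IsFiniteCompactification.mem_remainder_or (e := e) z with hzR | ⟨y, rfl⟩
  · exact absurd hzR (Set.disjoint_left.1 h.disjoint hz)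
  · exact ⟨y, rfl, (h.mem_iff y).1 hz⟩

theorem mem_of_mem (h : ClopensCorrespond e C K) {w : OmegaStar} (hw : w ∈ K) :
    ∃ y : ({x}ᶜ : Set OmegaStar), y.1 = w ∧ e y ∈ C := by
  have hwx : w ≠ x := fun hwx => h.notMem (hwx ▸ hw)
  exact ⟨⟨w, hwx⟩, rfl, (h.mem_iff ⟨w, hwx⟩).2 hw⟩

theorem inf (h : ClopensCorrespond e C K) (h' : ClopensCorrespond e C' K') :
    ClopensCorrespond e (C ⊓ C') (K ⊓ K') where
  disjoint := h.disjoint.mono_left Set.inter_subset_left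
  notMem hx := h.notMem hx.1
  mem_iff y := and_congr (h.mem_iff y) (h'.mem_iff y)

theorem le_iff (h : ClopensCorrespond e C K) (h' : ClopensCorrespond e C' K') :
    C ≤ C' ↔ K ≤ K' := by
  constructor
  · intro hle w hw
    obtain ⟨y, rfl, hy⟩ := h.mem_of_mem hw
    exact (h'.mem_iff y).1 (hle hy)
  · intro hle z hz
    obtain ⟨y, rfl, hy⟩ := h.exists_eq_of_mem hz
    exact (h'.mem_iff y).2 (hle hy)

theorem eq_bot_iff (h : ClopensCorrespond e C K) : C = ⊥ ↔ K = ⊥ := by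
  rw [← le_bot_iff, ← le_bot_iff]
  exact h.le_iff ⟨Set.empty_disjoint _, fun h => h, fun _ => Iff.rfl⟩

theorem disjoint_iff (h : ClopensCorrespond e C K) (h' : ClopensCorrespond e C' K') :
    Disjoint C C' ↔ Disjoint K K' := by
  rw [_root_.disjoint_iff, _root_.disjoint_iff, (h.inf h').eq_bot_iff]

end ClopensCorrespond

namespace IsFiniteCompactification

variable {x : OmegaStar} {Z : Type*} [TopologicalSpace Z] {e : ({x}ᶜ : Set OmegaStar) → Z}

theorem exists_clopens_omegaStar (he : IsFiniteCompactification e) {C : Clopens Z}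
    (hC : Disjoint (C : Set Z) (remainder e)) : ∃ K, ClopensCorrespond e C K := by
  have := he.compactSpace
  have hsub : (C : Set Z) ⊆ Set.range e := fun z hz => by
    by_contra h
    exact Set.disjoint_left.1 hC hz h
  have hcomp : IsCompact (e ⁻¹' C) :=
    (he.isEmbedding.isInducing.isCompact_preimage_iff hsub).2 C.isClosed.isCompact
  refine ⟨⟨Subtype.val '' (e ⁻¹' C), (hcomp.image continuous_subtype_val).isClosed,
    isOpen_compl_singleton.isOpenMap_subtype_val _
      (C.isOpen.preimage he.isEmbedding.continuous)⟩, hC, ?_, ?_⟩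
  · rintro ⟨y, -, hy⟩
    exact y.2 hy
  · intro y
    refine ⟨fun h => ⟨y, h, rfl⟩, ?_⟩
    rintro ⟨y', hy', h⟩
    exact Subtype.val_injective h ▸ hy'

theorem exists_clopens (he : IsFiniteCompactification e) {K : Clopens OmegaStar}
    (hK : x ∉ K) : ∃ C, ClopensCorrespond e C K := by
  have := he.t2Space
  have hsub : (K : Set OmegaStar) ⊆ Set.range (Subtype.val : ({x}ᶜ : Set OmegaStar) → _) := by
    intro w hw
    exact ⟨⟨w, fun h => hK (h ▸ hw)⟩, rfl⟩
  have hcomp : IsCompact (Subtype.val ⁻¹' (K : Set OmegaStar) : Set ({x}ᶜ : Set OmegaStar)) :=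
    (Topology.IsInducing.subtypeVal.isCompact_preimage_iff hsub).2 K.isClosed.isCompact
  refine ⟨⟨e '' (Subtype.val ⁻¹' K), (hcomp.image he.isEmbedding.continuous).isClosed,
    he.isOpenEmbedding.isOpenMap _ (K.isOpen.preimage continuous_subtype_val)⟩, ?_, hK, ?_⟩
  · rw [Set.disjoint_left]
    rintro _ ⟨y, -, rfl⟩ h
    exact h ⟨y, rfl⟩
  · intro y
    refine ⟨?_, fun h => ⟨y, h, rfl⟩⟩
    rintro ⟨y', hy', h⟩
    exact he.isEmbedding.injective h ▸ hy'

theorem totallyDisconnectedSpace (he : IsFiniteCompactification e) :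
    TotallyDisconnectedSpace Z := by
  have := he.t2Space
  refine ⟨fun t _ ht => ?_⟩
  by_cases hR : t ⊆ remainder e
  · have := (he.finite_remainder.subset hR).to_subtype
    have := isPreconnected_iff_preconnectedSpace.1 ht
    exact Set.subsingleton_coe _ |>.1 (PreconnectedSpace.trivial_of_discrete)
  -- a connected set which meets `ω* \ {x}` lies in every clopen neighbourhood of a point there
  · rw [Set.not_subset] at hR
    obtain ⟨z, hzt, hz⟩ := hR
    obtain ⟨y, rfl⟩ := (mem_remainder_or (e := e) z).resolve_left hz
    suffices h : ∀ z ∈ t, z = e y from fun a ha b hb => (h a ha).trans (h b hb).symm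
    intro z' hz'
    have hclopen : ∀ K : Clopens OmegaStar, x ∉ K → y.1 ∈ K →
        ∃ y', e y' = z' ∧ y'.1 ∈ K := by
      intro K hxK hyK
      obtain ⟨C, hC⟩ := he.exists_clopens hxK
      exact hC.exists_eq_of_mem
        (ht.subset_isClopen C.isClopen ⟨e y, hzt, (hC.mem_iff y).2 hyK⟩ hz')
    obtain ⟨K, hyK, hK⟩ := exists_clopens_mem_subset (isOpen_compl_singleton.mem_nhds y.2)
    have hxK : x ∉ K := fun h => hK h rfl
    obtain ⟨y', rfl, -⟩ := hclopen K hxK hyK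
    congr 1
    refine (Subtype.val_injective (eq_of_forall_mem_clopens fun C hC => ?_)).symm
    obtain ⟨y'', h, hy''⟩ := hclopen (K ⊓ C) (fun h => hxK h.1) ⟨hyK, hC⟩
    rw [he.isEmbedding.injective h] at hy''
    exact hy''.2

/-- The key property of `ω*`: since a clopen subset of `ω*` or its complement misses `x`, of two
countable families of clopen sets which miss the remainder and are disjoint from each other, at
least one is covered by a clopen set that misses the remainder and the other family. -/
theorem exists_separation (he : IsFiniteCompactification e) {U V : Set (Clopens Z)}
    (hU : U.Countable) (hV : V.Countable) (hUR : ∀ u ∈ U, Disjoint (u : Set Z) (remainder e))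
    (hVR : ∀ v ∈ V, Disjoint (v : Set Z) (remainder e)) (hUV : ∀ u ∈ U, ∀ v ∈ V, Disjoint u v) :
    ∃ C : Clopens Z, Disjoint (C : Set Z) (remainder e) ∧
      (((∀ u ∈ U, u ≤ C) ∧ ∀ v ∈ V, Disjoint v C) ∨
        ((∀ v ∈ V, v ≤ C) ∧ ∀ u ∈ U, Disjoint u C)) := by
  choose! κ hκ using fun C : Clopens Z => he.exists_clopens_omegaStar (C := C)
  obtain ⟨c, hcU, hcV⟩ := isParovicenkoAlgebra_clopens_omegaStar.separation (κ '' U) (κ '' V)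
    (hU.image _) (hV.image _) (by
      rintro _ ⟨u, hu, rfl⟩ _ ⟨v, hv, rfl⟩
      exact ((hκ u (hUR u hu)).disjoint_iff (hκ v (hVR v hv))).1 (hUV u hu v hv))
  by_cases hx : x ∈ c
  · obtain ⟨C, hC⟩ := he.exists_clopens (K := cᶜ) fun h => h hx
    refine ⟨C, hC.disjoint, Or.inr ⟨fun v hv => ?_, fun u hu => ?_⟩⟩
    · exact ((hκ v (hVR v hv)).le_iff hC).2 (hcV _ ⟨v, hv, rfl⟩).le_compl_right
    · exact ((hκ u (hUR u hu)).disjoint_iff hC).2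
        (disjoint_compl_right_iff.2 (hcU _ ⟨u, hu, rfl⟩))
  · obtain ⟨C, hC⟩ := he.exists_clopens hx
    refine ⟨C, hC.disjoint, Or.inl ⟨fun u hu => ?_, fun v hv => ?_⟩⟩
    · exact ((hκ u (hUR u hu)).le_iff hC).2 (hcU _ ⟨u, hu, rfl⟩)
    · exact ((hκ v (hVR v hv)).disjoint_iff hC).2 (hcV _ ⟨v, hv, rfl⟩)

/-- Every clopen neighbourhood of a point `p` contains a clopen neighbourhood of `p` with no remainder
point other than, possibly, `p`. -/
theorem exists_isolating (he : IsFiniteCompactification e) {p : Z} (W : Clopens Z) (hp : p ∈ W) :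
    ∃ C : Clopens Z, p ∈ C ∧ C ≤ W ∧ ∀ q ∈ remainder e, q ∈ C → q = p := by
  have := he.t2Space
  have := he.compactSpace
  have := he.totallyDisconnectedSpace
  have hfin : (remainder e \ {p}).Finite := he.finite_remainder.sdiff
  obtain ⟨C, hpC, hC⟩ := exists_clopens_mem_subset (x := p)
    ((W.isOpen.inter hfin.isClosed.isOpen_compl).mem_nhds ⟨hp, fun h => h.2 rfl⟩)
  refine ⟨C, hpC, fun z hz => (hC hz).1, fun q hqR hqC => ?_⟩
  by_contra hne
  exact (hC hqC).2 ⟨hqR, hne⟩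

theorem disjoint_sdiff_remainder {p : Z} {C d : Clopens Z}
    (hC : ∀ q ∈ remainder e, q ∈ C → q = p) (hd : p ∈ d) :
    Disjoint ((C \ d : Clopens Z) : Set Z) (remainder e) := by
  rw [Set.disjoint_left]
  rintro q ⟨hqC, hqd⟩ hqR
  exact hqd (hC q hqR hqC ▸ hd)

/-- A remainder point `p` is not a `Gδ` point: a decreasing sequence of clopen neighbourhoods of `p`,
the first of which contains no other remainder point, has a common point in `ω* \ {x}`. Otherwise
its intersection would be `{p}`, the complement of `p` in `d 0` would be the union of a sequence of
disjoint nonempty clopen sets, and the unions of the even and of the odd terms would both accumulate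
at `p`, contrary to `exists_separation`. -/
theorem exists_range_forall_mem_of_antitone (he : IsFiniteCompactification e) {p : Z}
    {d : ℕ → Clopens Z} (hd : Antitone d) (hpd : ∀ n, p ∈ d n)
    (hd0 : ∀ q ∈ remainder e, q ∈ d 0 → q = p) : ∃ y, ∀ n, e y ∈ d n := by
  have := he.compactSpace
  by_contra! hno
  have hex : ∀ n, ∃ m, n < m ∧ d n \ d m ≠ ⊥ := by
    intro n
    obtain ⟨_, hz, y, rfl⟩ := he.denseRange.inter_open_nonempty _ (d n).isOpen ⟨p, hpd n⟩
    obtain ⟨m, hm⟩ := hno y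
    refine ⟨max m (n + 1), lt_max_of_lt_right (Nat.lt_succ_self n), fun h => ?_⟩
    exact hm (hd (le_max_left _ _) (sdiff_eq_bot_iff.1 h hz))
  choose m hm hmd using hex
  let φ : ℕ → ℕ := fun k => m^[k] 0
  have hφs : ∀ k, φ (k + 1) = m (φ k) := fun k => Function.iterate_succ_apply' m k 0
  have hφ : StrictMono φ := strictMono_nat_of_lt_succ fun k => by rw [hφs]; exact hm _
  let s : ℕ → Clopens Z := fun k => d (φ k) \ d (φ (k + 1))
  have hs : ∀ k, s k ≠ ⊥ := fun k => by
    simp only [s, hφs]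
    exact hmd _
  have hsR : ∀ k, Disjoint (s k : Set Z) (remainder e) := fun k =>
    disjoint_sdiff_remainder (fun q hqR hq => hd0 q hqR (hd (Nat.zero_le _) hq)) (hpd _)
  have hlt : ∀ i j, i < j → Disjoint (s i) (s j) := fun i j hij =>
    disjoint_sdiff_self_left.mono_right (sdiff_le.trans (hd (hφ.monotone hij)))
  obtain ⟨C, hCR, hC⟩ := he.exists_separation (U := Set.range fun k => s (2 * k))
    (V := Set.range fun k => s (2 * k + 1)) (Set.countable_range _) (Set.countable_range _)
    (by rintro _ ⟨k, rfl⟩; exact hsR _) (by rintro _ ⟨k, rfl⟩; exact hsR _) (by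
      rintro _ ⟨i, rfl⟩ _ ⟨j, rfl⟩
      rcases lt_or_gt_of_ne (show 2 * i ≠ 2 * j + 1 by omega) with h | h
      · exact hlt _ _ h
      · exact (hlt _ _ h).symm)
  -- by compactness, some `d n` is disjoint from `C`
  have hn : ∃ n, d n ⊓ C = ⊥ := by
    by_contra! hne
    obtain ⟨z, hz⟩ := exists_forall_mem_clopens (D := Set.range fun n => d n ⊓ C)
      (Set.range_nonempty _) (by
        rintro _ ⟨i, rfl⟩ _ ⟨j, rfl⟩
        rcases le_total i j with hij | hij
        · exact ⟨j, (inf_eq_right.2 (inf_le_inf_right C (hd hij))).symm⟩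
        · exact ⟨i, (inf_eq_left.2 (inf_le_inf_right C (hd hij))).symm⟩) (by
        rintro ⟨n, h⟩
        exact hne n h)
    have hzd : ∀ n, z ∈ d n := fun n => (hz _ ⟨n, rfl⟩).1
    rcases mem_remainder_or (e := e) z with hzR | ⟨y, rfl⟩
    · exact Set.disjoint_left.1 hCR (hz _ ⟨0, rfl⟩).2 hzR
    · obtain ⟨n, hn⟩ := hno y
      exact hn (hzd n)
  obtain ⟨n, hn⟩ := hn
  have hsC : ∀ k, n ≤ k → ¬ s k ≤ C := fun k hk hle => hs k <| le_bot_iff.1 <| hn ▸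
    le_inf (sdiff_le.trans (hd (hk.trans (hφ.le_apply)))) hle
  rcases hC with ⟨hC, -⟩ | ⟨hC, -⟩
  · exact hsC (2 * n) (by omega) (hC _ ⟨n, rfl⟩)
  · exact hsC (2 * n + 1) (by omega) (hC _ ⟨n, rfl⟩)

/-- A filter base of countably many nonempty clopen sets has a common point outside the remainder. -/
theorem exists_range_mem_of_mem_clopens (he : IsFiniteCompactification e) {D : Set (Clopens Z)}
    (hD : D.Countable) (hne : D.Nonempty) (hinf : InfClosed D) (hbot : ⊥ ∉ D) :
    ∃ y, ∀ d ∈ D, e y ∈ d := by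
  have := he.compactSpace
  obtain ⟨p, hp⟩ := exists_forall_mem_clopens hne hinf hbot
  obtain ⟨δ, rfl⟩ := hD.exists_eq_range hne
  obtain ⟨C, hpC, -, hC⟩ := he.exists_isolating (p := p) ⊤ trivial
  let d : ℕ → Clopens Z := fun n => Nat.rec C (fun n c => c ⊓ δ n) n
  obtain ⟨y, hy⟩ := he.exists_range_forall_mem_of_antitone (d := d)
    (antitone_nat_of_succ_le fun n => inf_le_left) (fun n => by
      induction n with
      | zero => exact hpC
      | succ n ih => exact ⟨ih, hp _ ⟨n, rfl⟩⟩) hC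
  refine ⟨y, ?_⟩
  rintro _ ⟨n, rfl⟩
  exact (hy (n + 1)).2

/-! ### The clopen algebra of a finite compactification -/

theorem exists_clopens_le (he : IsFiniteCompactification e) {W : Clopens Z} {y} (hy : e y ∈ W) :
    ∃ C ≤ W, e y ∈ C ∧ Disjoint (C : Set Z) (remainder e) := by
  have := he.t2Space
  have := he.compactSpace
  have := he.totallyDisconnectedSpace
  obtain ⟨C, hyC, hC⟩ := exists_clopens_mem_subset
    ((W.isOpen.inter he.isOpenEmbedding.isOpen_range).mem_nhds ⟨hy, y, rfl⟩)
  refine ⟨C, fun z hz => (hC hz).1, hyC, ?_⟩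
  rw [Set.disjoint_left]
  exact fun z hz hzR => hzR (hC hz).2

theorem exists_mem_of_ne_bot (he : IsFiniteCompactification e) {a : Clopens Z} (ha : a ≠ ⊥) :
    ∃ y, e y ∈ a := by
  have hne : (a : Set Z).Nonempty := by
    rw [Set.nonempty_iff_ne_empty]
    exact fun h => ha (Clopens.ext h)
  obtain ⟨_, hz, y, rfl⟩ := he.denseRange.inter_open_nonempty _ a.isOpen hne
  exact ⟨y, hz⟩

/-- Off the remainder all properties are inherited from `ω*`. A remainder point enters separation
only through finitely many members of the two families, and it is never the whole intersection of
the family in `lower_bound`. -/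
theorem isParovicenkoAlgebra_clopens (he : IsFiniteCompactification e) :
    IsParovicenkoAlgebra (Clopens Z) where
  bot_ne_top := by
    obtain ⟨b, hb, -, hb'⟩ := isParovicenkoAlgebra_clopens_omegaStar.atomless ⊤
      isParovicenkoAlgebra_clopens_omegaStar.bot_ne_top.symm
    rw [top_sdiff] at hb'
    -- one of `b` and `bᶜ` misses `x`
    have hK : ∃ K : Clopens OmegaStar, K ≠ ⊥ ∧ x ∉ K := by
      by_cases hx : x ∈ b
      · exact ⟨bᶜ, hb', fun h => h hx⟩
      · exact ⟨b, hb, hx⟩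
    obtain ⟨K, hK, hxK⟩ := hK
    obtain ⟨C, hC⟩ := he.exists_clopens hxK
    intro h
    exact hK (hC.eq_bot_iff.1 (le_bot_iff.1 (h ▸ le_top)))
  atomless a ha := by
    obtain ⟨y, hy⟩ := he.exists_mem_of_ne_bot ha
    obtain ⟨C, hCa, hyC, hC⟩ := he.exists_clopens_le hy
    obtain ⟨K, hK⟩ := he.exists_clopens_omegaStar hC
    have hK0 : K ≠ ⊥ := fun h => by
      have := (hK.mem_iff y).1 hyC
      rw [h] at this
      exact this
    obtain ⟨b, hb, hbK, hKb⟩ := isParovicenkoAlgebra_clopens_omegaStar.atomless K hK0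
    obtain ⟨B, hB⟩ := he.exists_clopens fun h => hK.notMem (hbK h)
    refine ⟨B, mt hB.eq_bot_iff.1 hb, ((hB.le_iff hK).2 hbK).trans hCa, fun h => hKb ?_⟩
    exact sdiff_eq_bot_iff.2 ((hK.le_iff hB).1 (hCa.trans (sdiff_eq_bot_iff.1 h)))
  separation U V hU hV hUV := by
    -- finitely many members of a family cover the remainder points covered by the family
    have hfin : ∀ U : Set (Clopens Z), ∃ t : Finset (Clopens Z), ↑t ⊆ U ∧
        ∀ u ∈ U, Disjoint ((u \ t.sup id : Clopens Z) : Set Z) (remainder e) := by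
      classical
      intro U
      choose! w hw using fun p (h : ∃ u ∈ U, p ∈ u) => h
      have hfin : {p ∈ remainder e | ∃ u ∈ U, p ∈ u}.Finite :=
        he.finite_remainder.subset (Set.sep_subset _ _)
      refine ⟨hfin.toFinset.image w, ?_, fun u hu => ?_⟩
      · intro u hu
        obtain ⟨p, hp, rfl⟩ := Finset.mem_image.1 hu
        exact (hw p (hfin.mem_toFinset.1 hp).2).1
      · rw [Set.disjoint_left]
        rintro p ⟨hpu, hp⟩ hpR
        have hpU : ∃ u ∈ U, p ∈ u := ⟨u, hu, hpu⟩
        refine hp (Finset.le_sup (f := id) (Finset.mem_image_of_mem w ?_) (hw p hpU).2)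
        exact hfin.mem_toFinset.2 ⟨hpR, hpU⟩
    obtain ⟨s, hsU, hs⟩ := hfin U
    obtain ⟨t, htV, ht⟩ := hfin V
    set a := s.sup id
    set b := t.sup id
    have ha : ∀ v ∈ V, Disjoint a v := fun v hv =>
      Finset.disjoint_sup_left.2 fun u hu => hUV u (hsU hu) v hv
    have hb : ∀ u ∈ U, Disjoint u b := fun u hu =>
      Finset.disjoint_sup_right.2 fun v hv => hUV u hu v (htV hv)
    have hC : ∃ C, (∀ u ∈ U, u \ a ≤ C) ∧ ∀ v ∈ V, Disjoint (v \ b) C := by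
      obtain ⟨C, -, ⟨h1, h2⟩ | ⟨h1, h2⟩⟩ := he.exists_separation
        (U := (· \ a) '' U) (V := (· \ b) '' V) (hU.image _) (hV.image _)
        (by rintro _ ⟨u, hu, rfl⟩; exact hs u hu) (by rintro _ ⟨v, hv, rfl⟩; exact ht v hv) (by
          rintro _ ⟨u, hu, rfl⟩ _ ⟨v, hv, rfl⟩
          exact (hUV u hu v hv).mono sdiff_le sdiff_le)
      · exact ⟨C, fun u hu => h1 _ ⟨u, hu, rfl⟩, fun v hv => h2 _ ⟨v, hv, rfl⟩⟩
      · exact ⟨Cᶜ, fun u hu => (h2 _ ⟨u, hu, rfl⟩).le_compl_right,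
          fun v hv => disjoint_compl_right_iff.2 (h1 _ ⟨v, hv, rfl⟩)⟩
    obtain ⟨C, hCU, hCV⟩ := hC
    refine ⟨(C ⊔ a) \ b, fun u hu => le_sdiff.2 ⟨?_, hb u hu⟩, fun v hv => ?_⟩
    · rw [sup_comm]
      exact sdiff_le_iff.1 (hCU u hu)
    · rw [← sup_inf_sdiff v b]
      refine Disjoint.sup_left ?_ (Disjoint.mono_right sdiff_le (Disjoint.sup_right (hCV v hv) ?_))
      · exact disjoint_sdiff_self_right.mono_left inf_le_right
      · exact (ha v hv).symm.mono_left sdiff_le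
  lower_bound D hD hne hinf hbot := by
    obtain ⟨y, hy⟩ := he.exists_range_mem_of_mem_clopens hD hne hinf hbot
    obtain ⟨W, -, hyW, hW⟩ := he.exists_clopens_le (W := ⊤) (y := y) trivial
    choose! κ hκ using fun C : Clopens Z => he.exists_clopens_omegaStar (C := C)
    have hκ' : ∀ d, ClopensCorrespond e (d ⊓ W) (κ (d ⊓ W)) := fun d =>
      hκ _ (hW.mono_left Set.inter_subset_right)
    obtain ⟨b, hb, hbD⟩ := isParovicenkoAlgebra_clopens_omegaStar.lower_bound
      ((fun d => κ (d ⊓ W)) '' D) (hD.image _) (hne.image _) (by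
        rintro _ ⟨d, hd, rfl⟩ _ ⟨d', hd', rfl⟩
        refine ⟨d ⊓ d', hinf hd hd', ?_⟩
        have h1 := hκ' (d ⊓ d')
        have h2 := (hκ' d).inf (hκ' d')
        rw [← inf_inf_distrib_right] at h2
        exact le_antisymm ((h1.le_iff h2).1 le_rfl) ((h2.le_iff h1).1 le_rfl)) (by
        rintro ⟨d, hd, h⟩
        have := ((hκ' d).mem_iff y).1 ⟨hy d hd, hyW⟩
        rw [show κ (d ⊓ W) = ⊥ from h] at this
        exact this)
    obtain ⟨d₀, hd₀⟩ := hne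
    obtain ⟨B, hB⟩ := he.exists_clopens fun h => (hκ' d₀).notMem (hbD _ ⟨d₀, hd₀, rfl⟩ h)
    exact ⟨B, mt hB.eq_bot_iff.1 hb, fun d hd =>
      ((hB.le_iff (hκ' d)).2 (hbD _ ⟨d, hd, rfl⟩)).trans inf_le_left⟩

/-- A clopen set of the compactification is determined by its trace on the remainder and by its
symmetric difference from a fixed clopen set with that trace; the latter lives in `ω*`. -/
theorem exists_surjective_clopens (he : IsFiniteCompactification e) :
    ∃ f : Set ℕ → Clopens Z, Function.Surjective f := by
  classical
  have := he.finite_remainder.to_subtype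
  let tr : Clopens Z → Set (remainder e) := fun C => {p | p.1 ∈ C}
  choose! ρ hρ using fun (r : Set (remainder e)) (h : ∃ C, tr C = r) => h
  choose! κ hκ using fun C : Clopens Z => he.exists_clopens_omegaStar (C := C)
  have hκ' : ∀ C, ClopensCorrespond e (symmDiff C (ρ (tr C))) (κ (symmDiff C (ρ (tr C)))) := by
    intro C
    refine hκ _ (Set.disjoint_left.2 fun p hp hpR => ?_)
    have h : p ∈ ρ (tr C) ↔ p ∈ C := Set.ext_iff.1 (hρ (tr C) ⟨C, rfl⟩) ⟨p, hpR⟩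
    rcases hp with ⟨h1, h2⟩ | ⟨h1, h2⟩
    · exact h2 (h.2 h1)
    · exact h2 (h.1 h1)
  have hinj : Function.Injective fun C => (tr C, κ (symmDiff C (ρ (tr C)))) := by
    intro C C' h
    obtain ⟨h1, h2⟩ := Prod.ext_iff.1 h
    have hC := hκ' C
    have hC' := hκ' C'
    simp only at h1 h2
    rw [← h2, ← h1] at hC'
    exact symmDiff_left_injective _
      (le_antisymm ((hC.le_iff hC').2 le_rfl) ((hC'.le_iff hC).2 le_rfl))
  have hω : #(Clopens OmegaStar) ≤ 𝔠 := by
    simpa using Cardinal.mk_le_of_surjective starClopen_surjective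
  have hcard : #(Clopens Z) ≤ 𝔠 := by
    refine (Cardinal.mk_le_of_injective hinj).trans ?_
    rw [Cardinal.mk_prod, ← Cardinal.continuum_mul_self]
    refine mul_le_mul' ?_ ?_
    · rw [Cardinal.lift_le_continuum]
      exact (Cardinal.mk_le_aleph0 (α := Set (remainder e))).trans Cardinal.aleph0_le_continuum
    · rwa [Cardinal.lift_le_continuum]
  obtain ⟨g⟩ : Nonempty (Clopens Z ↪ Set ℕ) := by
    rw [← Cardinal.lift_mk_le']
    simpa using hcard
  exact ⟨Function.invFun g, Function.invFun_surjective g.injective⟩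

/-! ### Points of the remainder that are not `P`-points -/

/-- A point that is not a `P`-point is an accumulation point of the union of countably many clopen
sets that miss the remainder. -/
theorem exists_countable_of_not_isPPoint (he : IsFiniteCompactification e) {p : Z}
    (hp : ¬ IsPPoint p) {W : Clopens Z} (hpW : p ∈ W) :
    ∃ U : Set (Clopens Z), U.Countable ∧ (∀ u ∈ U, Disjoint (u : Set Z) (remainder e)) ∧
      (∀ u ∈ U, u ≤ W) ∧ ∀ C : Clopens Z, p ∈ C → ∃ u ∈ U, ¬ Disjoint u C := by
  have := he.t2Space
  have := he.compactSpace
  have := he.totallyDisconnectedSpace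
  obtain ⟨N, hpN, hNW, hN⟩ := he.exists_isolating W hpW
  simp only [IsPPoint, not_forall] at hp
  obtain ⟨S, hS, hSp, hno⟩ := hp
  choose! c hpc hc using fun s (hs : s ∈ S) => exists_clopens_mem_subset (hSp s hs)
  refine ⟨(fun s => N \ c s) '' S, hS.image _, ?_, ?_, fun C hpC => ?_⟩
  · rintro _ ⟨s, hs, rfl⟩
    exact disjoint_sdiff_remainder hN (hpc s hs)
  · rintro _ ⟨s, hs, rfl⟩
    exact sdiff_le.trans hNW
  · by_contra! hdisj
    refine hno ⟨(N ⊓ C : Clopens Z), (N ⊓ C).isOpen, ⟨hpN, hpC⟩, ?_⟩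
    rintro z ⟨hzN, hzC⟩ s hs
    by_contra hzs
    have h := Clopens.coe_disjoint.2 (hdisj _ ⟨s, hs, rfl⟩)
    exact Set.disjoint_left.1 h ⟨hzN, fun h => hzs (hc s hs h)⟩ hzC

/-- Two remainder points that are not `P`-points would be accumulated by two countable families of
clopen sets off the remainder, separated from each other, contrary to `exists_separation`. -/
theorem subsingleton_not_isPPoint (he : IsFiniteCompactification e) :
    {p ∈ remainder e | ¬ IsPPoint p}.Subsingleton := by
  have := he.t2Space
  have := he.compactSpace
  have := he.totallyDisconnectedSpace
  rintro p ⟨hpR, hp⟩ q ⟨hqR, hq⟩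
  refine eq_of_forall_mem_clopens fun W hpW => ?_
  by_contra hqW
  obtain ⟨U, hU, hUR, hUW, hUp⟩ := he.exists_countable_of_not_isPPoint hp hpW
  obtain ⟨V, hV, hVR, hVW, hVq⟩ := he.exists_countable_of_not_isPPoint hq (W := Wᶜ) hqW
  obtain ⟨C, hCR, ⟨hC, -⟩ | ⟨hC, -⟩⟩ := he.exists_separation hU hV hUR hVR
    fun u hu v hv => disjoint_compl_right.mono (hUW u hu) (hVW v hv)
  · obtain ⟨u, hu, huC⟩ := hUp Cᶜ fun h => Set.disjoint_left.1 hCR h hpR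
    exact huC (disjoint_compl_right_iff.2 (hC u hu))
  · obtain ⟨v, hv, hvC⟩ := hVq Cᶜ fun h => Set.disjoint_left.1 hCR h hqR
    exact hvC (disjoint_compl_right_iff.2 (hC v hv))

end IsFiniteCompactification

theorem theorem3p2 (hCH : (ℵ₁ : Cardinal.{0}) = 𝔠) (x : OmegaStar)
    {Z : Type*} [TopologicalSpace Z] (e : ({x}ᶜ : Set OmegaStar) → Z)
    (he : IsFiniteCompactification e) :
    Nonempty (Z ≃ₜ OmegaStar) ∧ {p ∈ remainder e | ¬ IsPPoint p}.Subsingleton := by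
  have := he.t2Space
  have := he.compactSpace
  have := he.totallyDisconnectedSpace
  obtain ⟨f, hf⟩ := he.exists_surjective_clopens
  obtain ⟨φ⟩ := IsParovicenkoAlgebra.nonempty_orderIso hCH he.isParovicenkoAlgebra_clopens
    isParovicenkoAlgebra_clopens_omegaStar hf starClopen_surjective
  exact ⟨nonempty_homeomorph_of_clopens_orderIso φ, he.subsingleton_not_isPPoint⟩
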